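/- **Networks.** A network $G=(V,E,\ell)$ is an undirected graph $(V,E)$ (loops allowed) together with a label $\ell(u,v)\in\{0,1,2,\dots\}$ for each ordered pair with $\{u,v\}\in E$. An automorphism is a permutation of $V$ preserving adjacency, non-adjacency and labels; two vertices are equivalent if an automorphism maps one to the other. The quotient graph $G^\ast$ is obtained from $G$ by identifying equivalent vertices and preserving adjacencies. **Configurations.** An arrangement of $k$ robots is a map $a\colon\{0,\dots,k-1\}\to V$. Arrangements $a_1,a_2$ are equivalent under an automorphism $\alpha$ and a permutation $\pi$ of $\{0,\dots,k-1\}$ if $\alpha\circ a_1=a_2\circ\pi$; the equivalence classes of arrangements are the configurations, forming the set $\mathcal C(G,k)$. Vertices $v,v'$ are equivalent in $a$ if $\alpha(v)=v'$ for some $\alpha,\pi$ under which $a$ is equivalent to itself. A class of indistinguishable vertices of a configuration $C$ assigns to each arrangement $a\in C$ an equivalence class $U(a)$ of vertices in $a$, so that $\alpha(U(a_1))=U(a_2)$ whenever $a_1,a_2\in C$ are equivalent under $\alpha,\pi$. **Algorithms and systems.** An algorithm $A$ for $k$ robots on $G$ maps each pair $(C,U)$, with $C\in\mathcal C(G,k)$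 and $U$ a class of indistinguishable vertices of $C$, to a class $U'=A(C,U)$ of indistinguishable vertices of $C$ such that for all $a\in C$ and $u\in U(a)$ some $u'\in U'(a)$ is equal or adjacent to $u$. An execution is a sequence $(C_i)_{i\ge 0}$ of configurations. A system $(G,k,S)$ consists of a network $G$, an integer $k\ge1$ and a scheduler $S$, i.e. a relation specifying which executions are possible for each algorithm. Under the fully synchronous scheduler $\mathcal F$, $(C_i)$ is possible for $A$ if for every $i$ and every $a\in C_i$ there is $a'\in C_{i+1}$ such that, for each robot $r$, $a'(r)$ is equal or adjacent to $a(r)$, and $a'(r)\in A(C_i,U)(a)$, where $U$ is the class with $a(r)\in U(a)$. **Simulation.** An algorithm $A$ under a system $\Psi=(G,k,S)$ simulates an algorithm $A'$ under $\Psi'=(G',k',S')$ if there is a surjective partial function $\varphi\colon\mathcal C(G,k)\to\mathcal C(G',k')$ such that for every execution $(C_i)$ of $A$ under $\Psi$ there is an execution $(C'_i)$ of $A'$ under $\Psi'$ for which either $\varphi(C_0)$ is undefined, or there is a weakly increasing surjection $\sigma\colon\mathbb N\to\mathbb N$ such that for all $i$, $\varphi(C_i)$ is defined and equals $C'_{\sigma(i)}$.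 The system $\Psi$ dominates $\Psi'$ if every algorithm under $\Psi'$ is simulated by some algorithm under $\Psi$. **Computing functions.** For $f\colon X\to X$ with $X=\{0,\dots,m-1\}$, let $\Gamma_f$ be the network on $X$ with edges $\{x,f(x)\}$ and labels $\ell(u,v)=v$, and let $A_f$ be the algorithm for one robot on $\Gamma_f$ that always moves the robot from $x$ to $f(x)$. A system computes $f$ if some algorithm under it simulates $A_f$ under $(\Gamma_f,1,\mathcal F)$. A set of systems is universal if for every $m\ge1$, every $f\colon\{0,\dots,m-1\}\to\{0,\dots,m-1\}$ is computed by some system in the set. **Oriented paths.** $OP_n^2$ is the system of two robots, under $\mathcal F$, on the path with vertices $0,\dots,n-1$ in which each edge is labeled $1$ in the direction $i\to i+1$ and $0$ in the direction $i+1\to i$. **Theorem.** Let $(G_n)_{n\ge1}$ be networks such that, for every $n\ge 1$, the quotient graph $G_n^\ast$ contains a sub-path of length at least $n$, meaning a path on at least $n$ distinct vertices. Then for every $n\ge1$ the system $(G_n,2,\mathcal F)$ dominates $OP_n^2$, and the set of systems $\{(G_n,2,\mathcal F)\mid n\ge1\}$ is universal. -/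

import Mathlib

universe u v

namespace RobotNet

/-- A network (labeled graph): an undirected graph, possibly with loops, whose ordered pairs of
adjacent vertices carry a label. The values of `label` off the edges are never used. -/
structure Network where
  V : Type u
  Adj : V → V → Prop
  symm : ∀ x y, Adj x y → Adj y x
  label : V → V → ℕ

/-- Automorphisms: permutations of the vertices preserving adjacencies and labels.
Adjacency is preserved in both directions; on finite networks one direction implies the other. -/
def IsAut (G : Network.{u}) (α : Equiv.Perm G.V) : Prop :=
  (∀ x y, G.Adj x y ↔ G.Adj (α x) (α y)) ∧
    ∀ x y, G.Adj x y → G.label x y = G.label (α x) (α y)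

theorem IsAut.one (G : Network.{u}) : IsAut G 1 :=
  ⟨fun _ _ => Iff.rfl, fun _ _ _ => rfl⟩

theorem IsAut.symm {G : Network.{u}} {α : Equiv.Perm G.V} (h : IsAut G α) : IsAut G α.symm := by
  refine ⟨fun x y => ?_, fun x y hxy => ?_⟩
  · simpa using (h.1 (α.symm x) (α.symm y)).symm
  · have h1 := h.1 (α.symm x) (α.symm y)
    have h2 := h.2 (α.symm x) (α.symm y)
    simp only [Equiv.apply_symm_apply] at h1 h2
    exact (h2 (h1.2 hxy)).symm

theorem IsAut.mul {G : Network.{u}} {α β : Equiv.Perm G.V} (hα : IsAut G α) (hβ : IsAut G β) :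
    IsAut G (α * β) :=
  ⟨fun x y => (hβ.1 x y).trans (hα.1 (β x) (β y)),
    fun x y h => (hβ.2 x y h).trans (hα.2 (β x) (β y) ((hβ.1 x y).1 h))⟩

/-- Equivalence of vertices of a network. -/
def vertexSetoid (G : Network.{u}) : Setoid G.V where
  r x y := ∃ α : Equiv.Perm G.V, IsAut G α ∧ α x = y
  iseqv :=
    { refl := fun _ => ⟨1, IsAut.one G, rfl⟩
      symm := by
        rintro _ _ ⟨α, h, rfl⟩
        exact ⟨α.symm, h.symm, by simp⟩
      trans := by
        rintro _ _ _ ⟨α, h, rfl⟩ ⟨β, h', rfl⟩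
        exact ⟨β * α, h'.mul h, rfl⟩ }

/-- The base graph of the quotient graph: equivalent vertices are identified, and two distinct
classes are adjacent when they have adjacent representatives. Loops and labels of the quotient
are left out, since they have no influence on its sub-paths. -/
def quotientGraph (G : Network.{u}) : SimpleGraph (Quotient (vertexSetoid G)) where
  Adj p q := p ≠ q ∧ ∃ x y : G.V, Quotient.mk (vertexSetoid G) x = p ∧
    Quotient.mk (vertexSetoid G) y = q ∧ G.Adj x y
  symm := ⟨by
    rintro p q ⟨hne, x, y, hx, hy, h⟩
    exact ⟨hne.symm, y, x, hy, hx, G.symm x y h⟩⟩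
  loopless := ⟨fun _ h => h.1 rfl⟩

/-- The graph has a sub-path with at least `n` vertices. -/
def HasSubpath {W : Type u} (H : SimpleGraph W) (n : ℕ) : Prop :=
  ∃ (x y : W) (p : H.Walk x y), p.IsPath ∧ n ≤ p.support.length

/-- Arrangements of `k` distinguishable robots. -/
abbrev Arrangement (G : Network.{u}) (k : ℕ) : Type u := Fin k → G.V

/-- The arrangements `a` and `b` are equivalent under `α` and `π`. -/
def EquivUnder {G : Network.{u}} {k : ℕ} (α : Equiv.Perm G.V) (π : Equiv.Perm (Fin k))
    (a b : Arrangement G k) : Prop :=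
  IsAut G α ∧ ∀ r, α (a r) = b (π r)

def arrangementSetoid (G : Network.{u}) (k : ℕ) : Setoid (Arrangement G k) where
  r a b := ∃ (α : Equiv.Perm G.V) (π : Equiv.Perm (Fin k)), EquivUnder α π a b
  iseqv :=
    { refl := fun _ => ⟨1, 1, IsAut.one G, fun _ => rfl⟩
      symm := by
        rintro a b ⟨α, π, h, hr⟩
        refine ⟨α.symm, π.symm, h.symm, fun r => ?_⟩
        have := hr (π.symm r)
        rw [Equiv.apply_symm_apply] at this
        rw [← this, Equiv.symm_apply_apply]
      trans := by
        rintro a b c ⟨α, π, h, hr⟩ ⟨β, ρ, h', hr'⟩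
        refine ⟨β * α, ρ * π, h'.mul h, fun r => ?_⟩
        simp only [Equiv.Perm.mul_apply, hr, hr'] }

/-- The configuration space. -/
def Config (G : Network.{u}) (k : ℕ) : Type u := Quotient (arrangementSetoid G k)

/-- The configuration of an arrangement. -/
def Config.of {G : Network.{u}} {k : ℕ} (a : Arrangement G k) : Config G k :=
  Quotient.mk (arrangementSetoid G k) a

/-- The arrangements belonging to a configuration. -/
def Config.arrs {G : Network.{u}} {k : ℕ} (C : Config G k) : Set (Arrangement G k) :=
  {a | Config.of a = C}

/-- Equivalence of the vertices `x` and `y` in the arrangement `a`. -/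
def EquivIn {G : Network.{u}} {k : ℕ} (a : Arrangement G k) (x y : G.V) : Prop :=
  ∃ (α : Equiv.Perm G.V) (π : Equiv.Perm (Fin k)), EquivUnder α π a a ∧ α x = y

/-- A class of indistinguishable vertices of the configuration `C`. -/
structure VertexClass {G : Network.{u}} {k : ℕ} (C : Config G k) where
  verts : C.arrs → Set G.V
  isClass : ∀ a : C.arrs, ∃ x, verts a = {y | EquivIn a.1 x y}
  equivariant : ∀ (a b : C.arrs) (α : Equiv.Perm G.V) (π : Equiv.Perm (Fin k)),
    EquivUnder α π a.1 b.1 → α '' verts a = verts b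

/-- An algorithm for `k` robots on `G`: from the current configuration and the class of the
location of the executing robot, it computes the class of its destination. -/
structure Algorithm (G : Network.{u}) (k : ℕ) where
  dest : (C : Config G k) → VertexClass C → VertexClass C
  reachable : ∀ (C : Config G k) (U : VertexClass C) (a : C.arrs), ∀ x ∈ U.verts a,
    ∃ y ∈ (dest C U).verts a, x = y ∨ G.Adj x y

/-- Executions are sequences of configurations. -/
abbrev Execution (G : Network.{u}) (k : ℕ) : Type u := ℕ → Config G k

/-- Schedulers are relations between algorithms and executions. -/
abbrev Scheduler (G : Network.{u}) (k : ℕ) : Type u := Algorithm G k → Execution G k → Prop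

/-- A system of oblivious mobile robots. -/
structure System where
  G : Network.{u}
  k : ℕ
  one_le : 1 ≤ k
  sched : Scheduler G k

/-- `C'` yields from `C` under `A`. -/
def Yields {G : Network.{u}} {k : ℕ} (A : Algorithm G k) (C C' : Config G k) : Prop :=
  ∀ a : C.arrs, ∃ a' : C'.arrs, ∀ r : Fin k,
    (a.1 r = a'.1 r ∨ G.Adj (a.1 r) (a'.1 r)) ∧
      ∀ U : VertexClass C, a.1 r ∈ U.verts a → a'.1 r ∈ (A.dest C U).verts a

/-- The fully synchronous scheduler. -/
def fullySync (G : Network.{u}) (k : ℕ) : Scheduler G k :=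
  fun A E => ∀ i, Yields A (E i) (E (i + 1))

/-- The system of `k` robots on `G` under the fully synchronous scheduler. -/
def FS (G : Network.{u}) (k : ℕ) (hk : 1 ≤ k) : System.{u} := ⟨G, k, hk, fullySync G k⟩

/-- Compliance of executions under a partial function (`none` means undefined). -/
def Compliant {G : Network.{u}} {k : ℕ} {G' : Network.{v}} {k' : ℕ}
    (φ : Config G k → Option (Config G' k')) (E : Execution G k) (E' : Execution G' k') : Prop :=
  φ (E 0) = none ∨
    ∃ σ : ℕ → ℕ, Monotone σ ∧ Function.Surjective σ ∧ ∀ i, φ (E i) = some (E' (σ i))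

/-- The algorithm `A` under `Ψ` simulates the algorithm `A'` under `Ψ'`. -/
def Simulates (Ψ : System.{u}) (A : Algorithm Ψ.G Ψ.k) (Ψ' : System.{v})
    (A' : Algorithm Ψ'.G Ψ'.k) : Prop :=
  ∃ φ : Config Ψ.G Ψ.k → Option (Config Ψ'.G Ψ'.k),
    (∀ D, ∃ C, φ C = some D) ∧
      ∀ E, Ψ.sched A E → ∃ E', Ψ'.sched A' E' ∧ Compliant φ E E'

/-- The system `Ψ` dominates `Ψ'`. -/
def Dominates (Ψ : System.{u}) (Ψ' : System.{v}) : Prop :=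
  ∀ A' : Algorithm Ψ'.G Ψ'.k, ∃ A : Algorithm Ψ.G Ψ.k, Simulates Ψ A Ψ' A'

/-- The network induced by a function: the edges are `{x, f x}` (loops included), and the label
of `(x, y)` is `y`. -/
def inducedNetwork {n : ℕ} (f : Fin n → Fin n) : Network.{0} where
  V := Fin n
  Adj x y := f x = y ∨ f y = x
  symm := fun _ _ h => h.symm
  label _ y := y

theorem eq_one_of_isAut_inducedNetwork {n : ℕ} (f : Fin n → Fin n)
    (α : Equiv.Perm (inducedNetwork f).V) (h : IsAut (inducedNetwork f) α) : α = 1 := by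
  refine Equiv.ext fun x => ?_
  have := h.2 (f x) x (Or.inr rfl)
  exact (Fin.val_injective this).symm

/-- The algorithm associated to a function, moving the robot from any vertex `x` to `f x`. -/
def inducedAlgorithm {n : ℕ} (f : Fin n → Fin n) : Algorithm (inducedNetwork f) 1 where
  dest C U :=
    { verts := fun a => f '' U.verts a
      isClass := fun a => by
        obtain ⟨x, hx⟩ := U.isClass a
        have key : ∀ z : (inducedNetwork f).V,
            {y | EquivIn a.1 z y} = ({z} : Set (inducedNetwork f).V) := by
          intro z
          ext y
          constructor
          · rintro ⟨α, π, h, rfl⟩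
            rw [eq_one_of_isAut_inducedNetwork f α h.1]
            rfl
          · rintro rfl
            exact ⟨1, 1, ⟨IsAut.one _, fun _ => rfl⟩, rfl⟩
        have hx' : U.verts a = ({x} : Set (inducedNetwork f).V) := hx.trans (key x)
        exact ⟨f x, (congrArg _ hx').trans (Set.image_singleton.trans (key (f x)).symm)⟩
      equivariant := fun a b α π h => by
        have hU := U.equivariant a b α π h
        rw [eq_one_of_isAut_inducedNetwork f α h.1] at hU ⊢
        rw [← hU]
        ext y
        simp }
  reachable := fun _ _ _ x hx => ⟨f x, ⟨x, hx, rfl⟩, Or.inr (Or.inl rfl)⟩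

/-- The system `Ψ` computes the function `f`. -/
def Computes (Ψ : System.{u}) {n : ℕ} (f : Fin n → Fin n) : Prop :=
  ∃ A : Algorithm Ψ.G Ψ.k,
    Simulates Ψ A (FS (inducedNetwork f) 1 le_rfl) (inducedAlgorithm f)

/-- A set of systems is universal if every function from `{0, …, n - 1}` to itself, `n ≥ 1`, is
computed by one of them. -/
def Universal (Υ : Set System.{u}) : Prop :=
  ∀ n : ℕ, 1 ≤ n → ∀ f : Fin n → Fin n, ∃ Ψ ∈ Υ, Computes Ψ f

/-- The oriented path with `n` vertices: label `1` to the right, label `0` to the left. -/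
def orientedPath (n : ℕ) : Network.{0} where
  V := Fin n
  Adj x y := x.val + 1 = y.val ∨ y.val + 1 = x.val
  symm := fun _ _ h => h.symm
  label x y := if x.val < y.val then 1 else 0

end RobotNet

-- Two facts suffice, since simulation composes (`Simulates.trans`).
--
-- Domination (`dominates_of_embedding`): automorphisms preserve the projection of a robot to the
-- quotient graph. If a network without nontrivial automorphisms embeds in the quotient, a robot
-- lying over a vertex of it can imitate any move there: an edge between two classes, transported by
-- an automorphism, starts at every vertex of the first class. Whatever vertex of the destination
-- class the scheduler picks, its projection is the same. Oriented paths have no nontrivial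
-- automorphisms, because the labels reveal the direction.
--
-- Computation (`computes_orientedPath`): on a path with `4 * m` vertices, two robots act as a
-- memory for a pair `x`, `y` in `Fin m` and a bit. Moving both robots the same way changes `y`,
-- moving them oppositely changes `x`, and moving only the left one flips the bit. With the current
-- value kept in `x`, `y` walks to `f x`; flipping the bit makes `y` the value; then `x` walks to
-- `y`, and the bit flips back.

universe w

namespace RobotNet

/-! ### Classes of indistinguishable vertices -/

section Classes

variable {G : Network.{u}} {k : ℕ}

theorem EquivUnder.mul {α β : Equiv.Perm G.V} {π ρ : Equiv.Perm (Fin k)}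
    {a b c : Arrangement G k} (h : EquivUnder α π a b) (h' : EquivUnder β ρ b c) :
    EquivUnder (β * α) (ρ * π) a c :=
  ⟨h'.1.mul h.1, fun r => by simp only [Equiv.Perm.mul_apply, h.2, h'.2]⟩

theorem EquivUnder.symm {α : Equiv.Perm G.V} {π : Equiv.Perm (Fin k)}
    {a b : Arrangement G k} (h : EquivUnder α π a b) : EquivUnder α.symm π.symm b a := by
  refine ⟨h.1.symm, fun r => ?_⟩
  have := h.2 (π.symm r)
  rw [Equiv.apply_symm_apply] at this
  rw [← this, Equiv.symm_apply_apply]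

theorem EquivUnder.refl (a : Arrangement G k) : EquivUnder 1 1 a a :=
  ⟨IsAut.one G, fun _ => rfl⟩

theorem Config.of_eq_of_iff {a b : Arrangement G k} :
    Config.of a = Config.of b ↔
      ∃ (α : Equiv.Perm G.V) (π : Equiv.Perm (Fin k)), EquivUnder α π a b :=
  Quotient.eq (r := arrangementSetoid G k)

theorem Config.exists_of_eq (C : Config G k) : ∃ a, Config.of a = C :=
  Quotient.exists_rep C

theorem Config.exists_equivUnder {C : Config G k} (a b : C.arrs) :
    ∃ (α : Equiv.Perm G.V) (π : Equiv.Perm (Fin k)), EquivUnder α π a.1 b.1 :=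
  Config.of_eq_of_iff.1 (a.2.trans b.2.symm)

theorem VertexClass.ext_verts {C : Config G k} {U U' : VertexClass C}
    (h : ∀ a, U.verts a = U'.verts a) : U = U' := by
  cases U; cases U'
  congr
  exact funext h

/-- The class of indistinguishable vertices containing the vertex `x` of the arrangement `a`. -/
def classOf {C : Config G k} (a : C.arrs) (x : G.V) : VertexClass C where
  verts b := {y | ∃ (α : Equiv.Perm G.V) (π : Equiv.Perm (Fin k)),
    EquivUnder α π a.1 b.1 ∧ α x = y}
  isClass b := by
    obtain ⟨α, π, h⟩ := Config.exists_equivUnder a b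
    refine ⟨α x, Set.ext fun y => ⟨?_, ?_⟩⟩
    · rintro ⟨β, ρ, h', rfl⟩
      exact ⟨_, _, h.symm.mul h', by simp⟩
    · rintro ⟨β, ρ, h', rfl⟩
      exact ⟨_, _, h.mul h', by simp⟩
  equivariant b c α π h := by
    ext y
    constructor
    · rintro ⟨_, ⟨β, ρ, h', rfl⟩, rfl⟩
      exact ⟨_, _, h'.mul h, by simp⟩
    · rintro ⟨β, ρ, h', rfl⟩
      exact ⟨α.symm (β x), ⟨_, _, h'.mul h.symm, by simp⟩, by simp⟩

theorem mem_classOf {C : Config G k} (a : C.arrs) (x : G.V) : x ∈ (classOf a x).verts a :=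
  ⟨1, 1, EquivUnder.refl _, rfl⟩

theorem mk_eq_of_isAut {α : Equiv.Perm G.V} (h : IsAut G α) (x : G.V) :
    Quotient.mk (vertexSetoid G) (α x) = Quotient.mk (vertexSetoid G) x :=
  (Quotient.sound (s := vertexSetoid G) ⟨α, h, rfl⟩).symm

theorem mk_eq_of_mem_classOf {C : Config G k} {a b : C.arrs} {x y : G.V}
    (h : y ∈ (classOf a x).verts b) :
    Quotient.mk (vertexSetoid G) y = Quotient.mk (vertexSetoid G) x := by
  obtain ⟨α, π, h, rfl⟩ := h
  exact mk_eq_of_isAut h.1 x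

theorem VertexClass.nonempty {C : Config G k} (U : VertexClass C) (a : C.arrs) :
    (U.verts a).Nonempty := by
  obtain ⟨x, hx⟩ := U.isClass a
  exact ⟨x, hx ▸ ⟨1, 1, EquivUnder.refl _, rfl⟩⟩

/-- One vertex determines the whole class: `isClass` fixes it within `a`, and equivariance carries
it to every other arrangement of the configuration. -/
theorem VertexClass.eq_classOf {C : Config G k} {U : VertexClass C} {a : C.arrs} {x : G.V}
    (hx : x ∈ U.verts a) : U = classOf a x := by
  refine VertexClass.ext_verts fun b => ?_
  obtain ⟨z, hz⟩ := U.isClass a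
  rw [hz] at hx
  obtain ⟨β, ρ, hβ, rfl⟩ := hx
  obtain ⟨γ, τ, hγ⟩ := Config.exists_equivUnder a b
  rw [← U.equivariant a b γ τ hγ, hz]
  ext y
  constructor
  · rintro ⟨_, ⟨δ, υ, hδ, rfl⟩, rfl⟩
    exact ⟨_, _, (hβ.symm.mul hδ).mul hγ, by simp⟩
  · rintro ⟨δ, υ, hδ, rfl⟩
    exact ⟨γ.symm (δ (β z)), ⟨_, _, (hβ.mul hδ).mul hγ.symm, by simp⟩, by simp⟩

/-- The class of a neighbour of `x` is reachable from the class of `x`. -/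
theorem classOf_reachable {C : Config G k} {a : C.arrs} {x y : G.V} (h : x = y ∨ G.Adj x y)
    (b : C.arrs) {z : G.V} (hz : z ∈ (classOf a x).verts b) :
    ∃ w ∈ (classOf a y).verts b, z = w ∨ G.Adj z w := by
  obtain ⟨α, π, hα, rfl⟩ := hz
  exact ⟨α y, ⟨α, π, hα, rfl⟩, h.imp (congrArg α) (hα.1.1 x y).1⟩

end Classes

/-! ### Networks without nontrivial automorphisms -/

section Rigid

/-- A network is rigid if it has no nontrivial automorphisms. -/
def Rigid (H : Network.{v}) : Prop := ∀ α : Equiv.Perm H.V, IsAut H α → α = 1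

variable {H : Network.{v}} {k : ℕ}

/-- Arrangements of one configuration now differ only by renaming robots, so a class is a single
vertex, the same in all of them. -/
theorem Rigid.mem_classOf_iff (hH : Rigid H) {C : Config H k} {a b : C.arrs} {x y : H.V} :
    y ∈ (classOf a x).verts b ↔ y = x := by
  constructor
  · rintro ⟨α, π, h, rfl⟩
    rw [hH α h.1]
    rfl
  · rintro rfl
    obtain ⟨α, π, h⟩ := Config.exists_equivUnder a b
    exact ⟨α, π, h, by rw [hH α h.1]; rfl⟩

theorem Rigid.mem_verts_iff (hH : Rigid H) {C : Config H k} {U : VertexClass C} {a b : C.arrs}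
    {x y : H.V} (hx : x ∈ U.verts a) : y ∈ U.verts b ↔ y = x := by
  rw [VertexClass.eq_classOf hx, hH.mem_classOf_iff]

theorem Rigid.of_eq_of_iff (hH : Rigid H) {a b : Arrangement H k} :
    Config.of a = Config.of b ↔ ∃ π : Equiv.Perm (Fin k), ∀ r, a r = b (π r) := by
  rw [Config.of_eq_of_iff]
  constructor
  · rintro ⟨α, π, h, h'⟩
    rw [hH α h] at h'
    exact ⟨π, h'⟩
  · rintro ⟨π, h⟩
    exact ⟨1, π, IsAut.one H, h⟩

/-- On a rigid network, an algorithm amounts to a map on the vertices for each configuration. -/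
theorem Rigid.exists_move (hH : Rigid H) (A : Algorithm H k) :
    ∃ g : Config H k → H.V → H.V, (∀ C x, x = g C x ∨ H.Adj x (g C x)) ∧
      ∀ b : Arrangement H k,
        Yields A (Config.of b) (Config.of fun r => g (Config.of b) (b r)) := by
  have key : ∀ (C : Config H k) (x : H.V), ∃ y, (x = y ∨ H.Adj x y) ∧
      ∀ (a : C.arrs) (U : VertexClass C), x ∈ U.verts a → y ∈ (A.dest C U).verts a := by
    intro C x
    obtain ⟨a, ha⟩ := C.exists_of_eq
    obtain ⟨y, hy, hxy⟩ := A.reachable C (classOf ⟨a, ha⟩ x) ⟨a, ha⟩ x (mem_classOf _ _)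
    refine ⟨y, hxy, fun b U hU => ?_⟩
    have hU' : x ∈ U.verts ⟨a, ha⟩ := (hH.mem_verts_iff hU).2 rfl
    rw [VertexClass.eq_classOf hU']
    exact (hH.mem_verts_iff hy).2 rfl
  choose g hg hg' using key
  refine ⟨g, hg, fun b a => ?_⟩
  obtain ⟨π, hπ⟩ := hH.of_eq_of_iff.1 a.2
  exact ⟨⟨fun r => g (Config.of b) (a.1 r), hH.of_eq_of_iff.2 ⟨π, fun r => by rw [hπ]⟩⟩,
    fun r => ⟨hg _ _, fun U hU => hg' _ _ a U hU⟩⟩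

/-- Simulation demands an execution of the simulated algorithm even when the partial function is
undefined at the start; this supplies one. -/
theorem Rigid.exists_fullySync (hH : Rigid H) (A : Algorithm H k) [Nonempty H.V] :
    ∃ E, fullySync H k A E := by
  obtain ⟨g, -, hg⟩ := hH.exists_move A
  choose rep hrep using Config.exists_of_eq (G := H) (k := k)
  let next : Config H k → Config H k := fun C => Config.of fun r => g C (rep C r)
  refine ⟨fun i => next^[i] (Config.of fun _ => Classical.arbitrary _), fun i => ?_⟩
  simp only [Function.iterate_succ_apply']
  generalize next^[i] _ = C
  have := hg (rep C)
  rwa [hrep] at this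

/-- The algorithm on a rigid network given by a map on the vertices for each configuration. -/
def Rigid.algorithm (hH : Rigid H) (g : Config H k → H.V → H.V)
    (hg : ∀ C x, x = g C x ∨ H.Adj x (g C x)) : Algorithm H k where
  dest C U :=
    { verts := fun a => g C '' U.verts a
      isClass := fun a => by
        obtain ⟨x, hx⟩ := U.nonempty a
        refine ⟨g C x, Set.ext fun y => ⟨?_, ?_⟩⟩
        · rintro ⟨z, hz, rfl⟩
          rw [(hH.mem_verts_iff hx).1 hz]
          exact ⟨1, 1, EquivUnder.refl _, rfl⟩
        · rintro ⟨α, π, h, rfl⟩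
          rw [hH α h.1]
          exact ⟨x, hx, rfl⟩
      equivariant := fun a b α π h => by
        rw [← U.equivariant a b α π h, hH α h.1]
        simp }
  reachable C _ _ x hx := ⟨g C x, ⟨x, hx, rfl⟩, hg C x⟩

/-- Destination classes are singletons, which leaves the scheduler no choice. -/
theorem Rigid.eq_of_yields_algorithm (hH : Rigid H) {g : Config H k → H.V → H.V}
    {hg : ∀ C x, x = g C x ∨ H.Adj x (g C x)} {b : Arrangement H k} {C : Config H k}
    (h : Yields (hH.algorithm g hg) (Config.of b) C) :
    C = Config.of fun r => g (Config.of b) (b r) := by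
  obtain ⟨a, ha⟩ := h ⟨b, rfl⟩
  rw [← a.2]
  congr 1
  funext r
  obtain ⟨z, hz, hz'⟩ := (ha r).2 _ (mem_classOf _ _)
  rw [← hz', hH.mem_classOf_iff.1 hz]

end Rigid

/-! ### Simulation through the quotient graph -/

section Dominates

/-- A network dominates every rigid network that embeds into its quotient graph. -/
theorem dominates_of_embedding {G : Network.{u}} {H : Network.{v}} {k : ℕ} (hk : 1 ≤ k)
    (hH : Rigid H) [Nonempty H.V] (ι : H.V → Quotient (vertexSetoid G))
    (hι : Function.Injective ι)
    (hadj : ∀ v w, H.Adj v w → (quotientGraph G).Adj (ι v) (ι w)) :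
    Dominates (FS G k hk) (FS H k hk) := by
  classical
  intro A'
  change Algorithm H k at A'
  obtain ⟨g, hg, hg'⟩ := hH.exists_move A'
  -- Adjacent classes have some adjacent representatives; an automorphism moves that edge so that it
  -- starts at `x`.
  have hstep : ∀ v w x, (v = w ∨ H.Adj v w) → Quotient.mk (vertexSetoid G) x = ι v →
      ∃ y, (x = y ∨ G.Adj x y) ∧ Quotient.mk (vertexSetoid G) y = ι w := by
    rintro v w x (rfl | h) hx
    · exact ⟨x, Or.inl rfl, hx⟩
    · obtain ⟨-, x', y', hx', hy', hxy⟩ := hadj v w h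
      obtain ⟨α, hα, rfl⟩ := Quotient.exact (hx'.trans hx.symm)
      exact ⟨α y', Or.inr ((hα.1 _ _).1 hxy), (mk_eq_of_isAut hα y').trans hy'⟩
  let IsImage : Config G k → Config H k → Prop := fun C D =>
    ∃ (a : Arrangement G k) (b : Arrangement H k), Config.of a = C ∧ Config.of b = D ∧
      ∀ r, Quotient.mk (vertexSetoid G) (a r) = ι (b r)
  have huniq : ∀ {C D D'}, IsImage C D → IsImage C D' → D = D' := by
    rintro C D D' ⟨a, b, ha, rfl, hab⟩ ⟨a', b', ha', rfl, hab'⟩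
    obtain ⟨α, π, h⟩ := Config.of_eq_of_iff.1 (ha.trans ha'.symm)
    refine hH.of_eq_of_iff.2 ⟨π, fun r => hι ?_⟩
    rw [← hab, ← hab', ← h.2, mk_eq_of_isAut h.1]
  let φ : Config G k → Option (Config H k) := fun C =>
    if h : ∃ D, IsImage C D then some h.choose else none
  have hφ : ∀ {C D}, φ C = some D ↔ IsImage C D := by
    intro C D
    by_cases h : ∃ D, IsImage C D
    · simp only [φ, dif_pos h, Option.some_inj]
      exact ⟨fun e => e ▸ h.choose_spec, huniq h.choose_spec⟩
    · simp only [φ, dif_neg h, reduceCtorEq, false_iff]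
      exact fun h' => h ⟨D, h'⟩
  -- The destination class is that of a vertex `y` over `g D v`, or `U` itself when `U` does not lie
  -- over the simulated network.
  have key : ∀ (C : Config G k) (U : VertexClass C), ∃ U' : VertexClass C,
      (∀ a, ∀ x ∈ U.verts a, ∃ y ∈ U'.verts a, x = y ∨ G.Adj x y) ∧
      ∀ D, IsImage C D → ∀ a v, (∀ x ∈ U.verts a, Quotient.mk (vertexSetoid G) x = ι v) →
        ∀ y ∈ U'.verts a, Quotient.mk (vertexSetoid G) y = ι (g D v) := by
    intro C U
    obtain ⟨a, ha⟩ := C.exists_of_eq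
    obtain ⟨x, hx⟩ := U.nonempty ⟨a, ha⟩
    obtain rfl := VertexClass.eq_classOf hx
    by_cases h : ∃ D v, IsImage C D ∧ Quotient.mk (vertexSetoid G) x = ι v
    · obtain ⟨D, v, hD, hv⟩ := h
      obtain ⟨y, hxy, hy⟩ := hstep v (g D v) x (hg D v) hv
      refine ⟨classOf ⟨a, ha⟩ y, fun b z hz => classOf_reachable hxy b hz, ?_⟩
      intro D' hD' b v' hv' z hz
      obtain rfl := huniq hD hD'
      obtain ⟨w, hw⟩ := (classOf ⟨a, ha⟩ x).nonempty b
      obtain rfl : v = v' := hι (by rw [← hv' w hw, mk_eq_of_mem_classOf hw, hv])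
      exact (mk_eq_of_mem_classOf hz).trans hy
    · refine ⟨classOf ⟨a, ha⟩ x, fun b z hz => ⟨z, hz, Or.inl rfl⟩, ?_⟩
      intro D hD b v hv
      obtain ⟨w, hw⟩ := (classOf ⟨a, ha⟩ x).nonempty b
      exact absurd ⟨D, v, hD, (mk_eq_of_mem_classOf hw).symm.trans (hv w hw)⟩ h
  choose dest hdest hdest' using key
  have hyield : ∀ {C C' : Config G k} {D}, IsImage C D → Yields ⟨dest, hdest⟩ C C' →
      ∃ D', IsImage C' D' ∧ Yields A' D D' := by
    rintro C C' D ⟨a, b, rfl, rfl, hab⟩ hC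
    obtain ⟨a', ha'⟩ := hC ⟨a, rfl⟩
    refine ⟨_, ⟨a'.1, fun r => g (Config.of b) (b r), a'.2, rfl, fun r => ?_⟩, hg' b⟩
    exact hdest' _ _ _ ⟨a, b, rfl, rfl, hab⟩ ⟨a, rfl⟩ (b r)
      (fun x hx => (mk_eq_of_mem_classOf hx).trans (hab r)) _
      ((ha' r).2 _ (mem_classOf ⟨a, rfl⟩ (a r)))
  refine ⟨⟨dest, hdest⟩, φ, fun D => ?_, fun E hE => ?_⟩
  · obtain ⟨b, rfl⟩ := Config.exists_of_eq D
    choose rep hrep using Quotient.exists_rep (s := vertexSetoid G)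
    exact ⟨Config.of fun r => rep (ι (b r)), hφ.2 ⟨_, b, rfl, rfl, fun r => hrep _⟩⟩
  · cases h0 : φ (E 0) with
    | none =>
      obtain ⟨E', hE'⟩ := hH.exists_fullySync A'
      exact ⟨E', hE', Or.inl h0⟩
    | some D0 =>
      have hdef : ∀ i, ∃ D, IsImage (E i) D := by
        intro i
        induction i with
        | zero => exact ⟨D0, hφ.1 h0⟩
        | succ i ih =>
          obtain ⟨D, hD⟩ := ih
          obtain ⟨D', hD', -⟩ := hyield hD (hE i)
          exact ⟨D', hD'⟩
      choose E' hE' using hdef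
      refine ⟨E', fun i => ?_, Or.inr ⟨id, monotone_id, Function.surjective_id,
        fun i => hφ.2 (hE' i)⟩⟩
      obtain ⟨D', hD', hy⟩ := hyield (hE' i) (hE i)
      rwa [huniq (hE' (i + 1)) hD']

theorem Simulates.trans {Ψ : System.{u}} {Ψ' : System.{v}} {Ψ'' : System.{w}}
    {A : Algorithm Ψ.G Ψ.k} {A' : Algorithm Ψ'.G Ψ'.k} {A'' : Algorithm Ψ''.G Ψ''.k}
    (h : Simulates Ψ A Ψ' A') (h' : Simulates Ψ' A' Ψ'' A'') : Simulates Ψ A Ψ'' A'' := by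
  obtain ⟨φ, hφ, hE⟩ := h
  obtain ⟨ψ, hψ, hE'⟩ := h'
  refine ⟨fun C => (φ C).bind ψ, fun D => ?_, fun E h => ?_⟩
  · obtain ⟨D', hD'⟩ := hψ D
    obtain ⟨C, hC⟩ := hφ D'
    exact ⟨C, by simp [hC, hD']⟩
  · obtain ⟨E', hs, hc⟩ := hE E h
    obtain ⟨E'', hs', hc'⟩ := hE' E' hs
    refine ⟨E'', hs', ?_⟩
    rcases hc with h0 | ⟨σ, hm, hsurj, hσ⟩
    · exact Or.inl (by simp [h0])
    · rcases hc' with h0 | ⟨τ, hm', hsurj', hτ⟩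
      · obtain ⟨i, hi⟩ := hsurj 0
        -- Being monotone and onto, `σ` fixes `0`, so an undefined value at `E' 0` makes the
        -- composite undefined at `E 0`.
        have h00 : σ 0 = 0 := Nat.le_zero.1 (le_of_le_of_eq (hm (Nat.zero_le i)) hi)
        exact Or.inl (by simp [hσ, h00, h0])
      · exact Or.inr ⟨τ ∘ σ, hm'.comp hm, hsurj'.comp hsurj, fun i => by simp [hσ, hτ]⟩

end Dominates

/-! ### Computing a function by a deterministic process -/

section Computation

/-- An embedded deterministic process: on a rigid network, an algorithm can follow a map `step` on
a set of states that are represented by distinct configurations of robots in distinct places. -/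
theorem Rigid.exists_algorithm_of_step {H : Network.{v}} {k : ℕ} (hH : Rigid H) {S : Type*}
    (arr : S → Arrangement H k) (step : S → S)
    (hinj : Function.Injective fun s => Config.of (arr s))
    (hsep : ∀ s, Function.Injective (arr s))
    (hadj : ∀ s r, arr s r = arr (step s) r ∨ H.Adj (arr s r) (arr (step s) r)) :
    ∃ A : Algorithm H k, ∀ s C, Yields A (Config.of (arr s)) C →
      C = Config.of (arr (step s)) := by
  -- The configuration determines the state by `hinj`, and then the vertex determines the robot by
  -- `hsep`, so the move is well defined.
  have key : ∀ (C : Config H k) (x : H.V), ∃ y, (x = y ∨ H.Adj x y) ∧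
      ∀ s r, C = Config.of (arr s) → x = arr s r → y = arr (step s) r := by
    intro C x
    by_cases h : ∃ s r, C = Config.of (arr s) ∧ x = arr s r
    · obtain ⟨s, r, rfl, rfl⟩ := h
      refine ⟨arr (step s) r, hadj s r, fun s' r' hs hr => ?_⟩
      obtain rfl : s = s' := hinj hs
      rw [hsep s hr]
    · exact ⟨x, Or.inl rfl, fun s r hs hr => absurd ⟨s, r, hs, hr⟩ h⟩
  choose g hg hg' using key
  refine ⟨hH.algorithm g hg, fun s C hC => ?_⟩
  rw [hH.eq_of_yields_algorithm hC]
  congr 1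
  funext r
  exact hg' _ _ s r rfl rfl

theorem rigid_inducedNetwork {m : ℕ} (f : Fin m → Fin m) : Rigid (inducedNetwork f) :=
  eq_one_of_isAut_inducedNetwork f

theorem yields_inducedAlgorithm {m : ℕ} (f : Fin m → Fin m) (x : Fin m) :
    Yields (inducedAlgorithm f) (Config.of fun _ => x) (Config.of fun _ => f x) := by
  intro a
  obtain ⟨π, hπ⟩ := (rigid_inducedNetwork f).of_eq_of_iff.1 a.2
  refine ⟨⟨fun _ => f x, rfl⟩, fun r => ?_⟩
  rw [hπ r]
  exact ⟨Or.inr (Or.inl rfl), fun U hU => ⟨x, hU, rfl⟩⟩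

/-- At the first index where `σ` reaches `j`, a unit step cannot have overshot it. -/
theorem surjective_of_unit_steps {σ : ℕ → ℕ} (h0 : σ 0 = 0) (h1 : ∀ i, σ (i + 1) ≤ σ i + 1)
    (hunb : ∀ j, ∃ i, j ≤ σ i) : Function.Surjective σ := by
  intro j
  classical
  have h := Nat.find_spec (hunb j)
  refine ⟨Nat.find (hunb j), le_antisymm ?_ h⟩
  cases hi : Nat.find (hunb j) with
  | zero => omega
  | succ i =>
    have := Nat.find_min (hunb j) (m := i) (by omega)
    have := h1 i
    omega

/-- A system computes `f` if one of its algorithms follows a process on states carrying values,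
where each step of the process either keeps the value or applies `f`, the latter occurring
again and again. -/
theorem computes_of_process {H : Network.{v}} {k : ℕ} (hk : 1 ≤ k) {m : ℕ} (hm : 1 ≤ m)
    (f : Fin m → Fin m) {S : Type*} (conf : S → Config H k) (hinj : Function.Injective conf)
    (step : S → S) (A : Algorithm H k)
    (hA : ∀ s C, Yields A (conf s) C → C = conf (step s))
    (val : S → Fin m) (hval : Function.Surjective val) (tick : S → Bool)
    (hstep : ∀ s, val (step s) = if tick s then f (val s) else val s)
    (μ : S → ℕ) (hμ : ∀ s, tick s = false → μ (step s) < μ s) :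
    Computes (FS H k hk) f := by
  classical
  let φ : Config H k → Option (Config (inducedNetwork f) 1) := fun C =>
    if h : ∃ s, conf s = C then some (Config.of fun _ => val h.choose) else none
  have hφ : ∀ s, φ (conf s) = some (Config.of fun _ => val s) := by
    intro s
    have h : ∃ t, conf t = conf s := ⟨s, rfl⟩
    simp only [φ, dif_pos h]
    rw [hinj h.choose_spec]
  have hexec : ∀ x : Fin m, fullySync (inducedNetwork f) 1 (inducedAlgorithm f)
      (fun j => Config.of fun _ => f^[j] x) := by
    intro x j
    simp only [Function.iterate_succ_apply']
    exact yields_inducedAlgorithm f _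
  refine ⟨A, φ, fun D => ?_, fun E hE => ?_⟩
  · obtain ⟨b, rfl⟩ := Config.exists_of_eq D
    obtain ⟨s, hs⟩ := hval (b (0 : Fin 1))
    refine ⟨conf s, (hφ s).trans ?_⟩
    rw [hs]
    congr 2
    funext r
    exact congrArg b (Subsingleton.elim (α := Fin 1) _ _)
  · by_cases h0 : ∃ s, conf s = E 0
    · obtain ⟨s, hs⟩ := h0
      have hconf : ∀ i, E i = conf (step^[i] s) := by
        intro i
        induction i with
        | zero => exact hs.symm
        | succ i ih =>
          have h := hE i
          rw [ih] at h
          rw [Function.iterate_succ_apply']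
          exact hA _ _ h
      -- `σ i` counts the applications of `f` among the first `i` steps.
      let σ : ℕ → ℕ := fun i => ∑ j ∈ Finset.range i, if tick (step^[j] s) then 1 else 0
      have hσ : ∀ i, σ (i + 1) = σ i + if tick (step^[i] s) then 1 else 0 :=
        fun i => Finset.sum_range_succ _ _
      have hmono : Monotone σ := monotone_nat_of_le_succ fun i => by rw [hσ]; omega
      have htick : ∀ N i, μ (step^[i] s) ≤ N → ∃ i', i ≤ i' ∧ tick (step^[i'] s) = true := by
        intro N
        induction N with
        | zero =>
          intro i hi
          refine ⟨i, le_rfl, ?_⟩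
          by_contra h
          have := hμ _ (Bool.eq_false_iff.2 h)
          omega
        | succ N ih =>
          intro i hi
          by_cases h : tick (step^[i] s) = true
          · exact ⟨i, le_rfl, h⟩
          · have := hμ _ (Bool.eq_false_iff.2 h)
            rw [← Function.iterate_succ_apply' step] at this
            obtain ⟨i', hi', ht⟩ := ih (i + 1) (Nat.le_of_lt_succ (this.trans_le hi))
            exact ⟨i', by omega, ht⟩
      have hunb : ∀ j, ∃ i, j ≤ σ i := by
        intro j
        induction j with
        | zero => exact ⟨0, Nat.zero_le _⟩
        | succ j ih =>
          obtain ⟨i, hi⟩ := ih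
          obtain ⟨i', hi', ht⟩ := htick _ i le_rfl
          refine ⟨i' + 1, ?_⟩
          rw [hσ, if_pos ht]
          have := hmono hi'
          omega
      have hvals : ∀ i, val (step^[i] s) = f^[σ i] (val s) := by
        intro i
        induction i with
        | zero => rfl
        | succ i ih =>
          rw [Function.iterate_succ_apply', hstep, hσ, ih]
          split_ifs
          · rw [Function.iterate_succ_apply']
          · rfl
      refine ⟨_, hexec (val s), Or.inr ⟨σ, hmono, surjective_of_unit_steps rfl (fun i => ?_) hunb,
        fun i => ?_⟩⟩
      · rw [hσ]
        split_ifs <;> omega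
      · rw [hconf, hφ, hvals]
        rfl
    · exact ⟨_, hexec ⟨0, hm⟩, Or.inl (dif_neg h0)⟩

end Computation

/-! ### Oriented paths as a two-robot memory -/

section OrientedPath

/-- Preserving labels forces an automorphism to be strictly increasing, and a finite linear order
has no order automorphism except the identity. -/
theorem rigid_orientedPath (n : ℕ) : Rigid (orientedPath n) := by
  intro α hα
  change Equiv.Perm (Fin n) at α
  have hsucc : ∀ x y : Fin n, x.val + 1 = y.val → (α x).val < (α y).val := by
    intro x y h
    have h' := hα.2 x y (Or.inl h)
    change (if x.val < y.val then 1 else 0) = if (α x).val < (α y).val then 1 else 0 at h'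
    by_contra hlt
    rw [if_pos (by omega), if_neg hlt] at h'
    exact one_ne_zero h'
  have hmono : StrictMono α := by
    have key : ∀ d (x y : Fin n), x.val + (d + 1) = y.val → (α x).val < (α y).val := by
      intro d
      induction d with
      | zero => exact hsucc
      | succ d ih =>
        intro x y h
        have hz : x.val + (d + 1) < n := by have := y.2; omega
        exact (ih x ⟨_, hz⟩ rfl).trans (hsucc _ _ (by simpa [add_assoc] using h))
    intro x y hxy
    have : x.val < y.val := hxy
    exact key (y.val - x.val - 1) x y (by omega)
  let e : Fin n ≃o Fin n := ⟨α, fun {x y} => hmono.le_iff_le⟩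
  exact Equiv.ext fun x => congrArg (fun e : Fin n ≃o Fin n => e x)
    (Subsingleton.elim e (OrderIso.refl _))

/-- One unit from `x` towards `y`. -/
def towards {m : ℕ} (x y : Fin m) : Fin m :=
  if h : x < y then ⟨x + 1, by omega⟩ else ⟨x - (if x = y then 0 else 1), by omega⟩

theorem towards_cases {m : ℕ} {x y : Fin m} (h : x ≠ y) :
    (x.val < y.val ∧ (towards x y).val = x.val + 1) ∨
      (y.val < x.val ∧ (towards x y).val + 1 = x.val) := by
  unfold towards
  rcases lt_or_gt_of_ne h with h' | h'
  · left
    simp [h', Fin.lt_def.1 h']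
  · right
    have : y.val < x.val := h'
    simp only [dif_neg (not_lt_of_gt h'), if_neg h]
    omega

/-- The states `(b, x, y)` of the computation of a function on `Fin m`: if `b` is false, the
current value is `x`, and `y` travels to its image; if `b` is true, the current value is `y`, and
`x` travels to `y`. -/
abbrev State (m : ℕ) : Type := Bool × Fin m × Fin m

variable {m : ℕ}

/-- The transition of states. -/
def State.step (f : Fin m → Fin m) : State m → State m
  | (false, x, y) => if y = f x then (true, x, y) else (false, x, towards y (f x))
  | (true, x, y) => if x = y then (false, x, y) else (true, towards x y, y)

/-- The value represented by a state. -/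
def State.val : State m → Fin m
  | (false, x, _) => x
  | (true, _, y) => y

/-- Whether the function is applied in the next transition. -/
def State.tick (f : Fin m → Fin m) : State m → Bool
  | (false, x, y) => decide (y = f x)
  | (true, _, _) => false

/-- A bound on the number of transitions before the function is applied. -/
def State.rank (f : Fin m → Fin m) : State m → ℕ
  | (false, x, y) => (y.val - (f x).val) + ((f x).val - y.val)
  | (true, x, y) => m + ((x.val - y.val) + (y.val - x.val))

/-- The robots representing a state. The sum and the difference of their positions are, up to
constants, `2 * y + b` and `2 * x + b`. -/
def State.arr (s : State m) : Arrangement (orientedPath (4 * m)) 2 :=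
  ![⟨s.2.1 + s.2.2 + s.1.toNat, by
      have := s.2.1.2; have := s.2.2.2; have := Bool.toNat_le s.1; omega⟩,
    ⟨3 * m + s.2.2 - s.2.1, by have := s.2.1.2; have := s.2.2.2; omega⟩]

theorem State.val_arr_zero (s : State m) :
    Fin.val (s.arr 0) = s.2.1.val + s.2.2.val + s.1.toNat := rfl

theorem State.val_arr_one (s : State m) :
    Fin.val (s.arr 1) = 3 * m + s.2.2.val - s.2.1.val := rfl

/-- Robot `0` stays below `2 * m` and robot `1` above it, so they cannot be exchanged. The parity of
the sum then gives the bit, and sum and difference give `y` and `x`. -/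
theorem State.arr_injective : Function.Injective fun s : State m => Config.of s.arr := by
  rintro ⟨b, x, y⟩ ⟨b', x', y'⟩ h
  obtain ⟨π, hπ⟩ := (rigid_orientedPath _).of_eq_of_iff.1 h
  have h0 : Fin.val (State.arr (b, x, y) 0) = Fin.val (State.arr (b', x', y') (π 0)) :=
    congrArg Fin.val (hπ 0)
  have h1 : Fin.val (State.arr (b, x, y) 1) = Fin.val (State.arr (b', x', y') (π 1)) :=
    congrArg Fin.val (hπ 1)
  have hne : π 0 ≠ π 1 := fun h => by simpa using π.injective h
  have hx := x.2
  have hy := y.2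
  have hx' := x'.2
  have hy' := y'.2
  have hb := Bool.toNat_le b
  have hb' := Bool.toNat_le b'
  have hval : x.val = x'.val ∧ y.val = y'.val ∧ b.toNat = b'.toNat := by
    rcases (em (π 0 = 0)).imp_right (Fin.eq_one_of_ne_zero _) with e0 | e0 <;>
      rcases (em (π 1 = 0)).imp_right (Fin.eq_one_of_ne_zero _) with e1 | e1 <;>
      simp only [e0, e1, State.val_arr_zero, State.val_arr_one] at h0 h1 hne <;>
      omega
  obtain ⟨e1, e2, e3⟩ := hval
  rw [Fin.ext e1, Fin.ext e2, show b = b' by cases b <;> cases b' <;> simp_all]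

theorem State.arr_separated (s : State m) : Function.Injective s.arr := by
  obtain ⟨b, x, y⟩ := s
  have hx := x.2
  have hy := y.2
  have hb := Bool.toNat_le b
  have h : Fin.val (State.arr (b, x, y) 0) ≠ Fin.val (State.arr (b, x, y) 1) := by
    simp only [State.val_arr_zero, State.val_arr_one]
    omega
  intro r r' hr
  fin_cases r <;> fin_cases r'
  · rfl
  · exact absurd (congrArg Fin.val hr) h
  · exact absurd (congrArg Fin.val hr).symm h
  · rfl

theorem State.arr_step (f : Fin m → Fin m) (s : State m) (r : Fin 2) :
    s.arr r = (s.step f).arr r ∨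
      (orientedPath (4 * m)).Adj (s.arr r) ((s.step f).arr r) := by
  have key : (s.arr r).val = ((s.step f).arr r).val ∨
      (s.arr r).val + 1 = ((s.step f).arr r).val ∨
      ((s.step f).arr r).val + 1 = (s.arr r).val := by
    obtain ⟨b, x, y⟩ := s
    have hx := x.2
    have hy := y.2
    cases b
    · by_cases h : y = f x
      · fin_cases r <;> simp [State.step, State.arr, h]
      · have := towards_cases h
        have := (f x).2
        fin_cases r <;> simp [State.step, State.arr, h] <;> omega
    · by_cases h : x = y
      · fin_cases r <;> simp [State.step, State.arr, h]
      · have := towards_cases h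
        fin_cases r <;> simp [State.step, State.arr, h] <;> omega
  exact key.imp Fin.ext id

theorem computes_orientedPath (hm : 1 ≤ m) (f : Fin m → Fin m) :
    Computes (FS (orientedPath (4 * m)) 2 one_le_two) f := by
  obtain ⟨A, hA⟩ := (rigid_orientedPath (4 * m)).exists_algorithm_of_step State.arr (State.step f)
    State.arr_injective State.arr_separated (State.arr_step f)
  refine computes_of_process one_le_two hm f _ State.arr_injective (State.step f) A hA State.val
    (fun x => ⟨(false, x, x), rfl⟩) (State.tick f) ?_ (State.rank f) ?_
  · rintro ⟨b, x, y⟩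
    cases b
    · by_cases h : y = f x <;> simp [State.step, State.tick, State.val, h]
    · by_cases h : x = y <;> simp [State.step, State.tick, State.val, h]
  · rintro ⟨b, x, y⟩ ht
    have hx := x.2
    have hy := y.2
    cases b
    · have h : y ≠ f x := by simpa [State.tick] using ht
      have := towards_cases h
      simp only [State.step, State.rank, if_neg h]
      omega
    · by_cases h : x = y
      -- The next rank is the distance from `x` to `f x`, less than `m`; hence the offset `m` while
      -- the bit is true.
      · have := (f x).2
        simp only [State.step, State.rank, if_pos h]
        omega
      · have := towards_cases h
        simp only [State.step, State.rank, if_neg h]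
        omega

theorem dominates_orientedPath {G : Network.{u}} {n : ℕ} (hn : 1 ≤ n)
    (h : HasSubpath (quotientGraph G) n) :
    Dominates (FS G 2 one_le_two) (FS (orientedPath n) 2 one_le_two) := by
  obtain ⟨x, y, p, hp, hlen⟩ := h
  rw [SimpleGraph.Walk.length_support] at hlen
  have : Nonempty (orientedPath n).V := ⟨(⟨0, hn⟩ : Fin n)⟩
  have hsucc : ∀ v w : Fin n, v.val + 1 = w.val →
      (quotientGraph G).Adj (p.getVert v.val) (p.getVert w.val) := by
    intro v w hvw
    rw [← hvw]
    exact p.adj_getVert_succ (by have := w.2; omega)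
  -- The first `n` vertices of the path are used; their indices are at most `p.length`, the range
  -- where `getVert` is injective.
  refine dominates_of_embedding one_le_two (rigid_orientedPath n)
    (fun v : Fin n => p.getVert v.val) (fun v w hvw => ?_) (fun v w hvw => ?_)
  · change Fin n at v w
    refine Fin.ext (hp.getVert_injOn ?_ ?_ hvw)
    · have := v.2
      simp only [Set.mem_ofPred_eq]
      omega
    · have := w.2
      simp only [Set.mem_ofPred_eq]
      omega
  · rcases hvw with hvw | hvw
    · exact hsucc v w hvw
    · exact (hsucc w v hvw).symm

end OrientedPath

end RobotNet

theorem mainTheorem4 (G : ℕ → RobotNet.Network.{u})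
    (hG : ∀ n : ℕ, 1 ≤ n → RobotNet.HasSubpath (RobotNet.quotientGraph (G n)) n) :
    (∀ n : ℕ, 1 ≤ n →
      RobotNet.Dominates (RobotNet.FS (G n) 2 one_le_two)
        (RobotNet.FS (RobotNet.orientedPath n) 2 one_le_two)) ∧
    RobotNet.Universal
      {Ψ : RobotNet.System.{u} | ∃ n : ℕ, 1 ≤ n ∧ Ψ = RobotNet.FS (G n) 2 one_le_two} := by
  have hdom := fun n hn => RobotNet.dominates_orientedPath hn (hG n hn)
  refine ⟨hdom, fun m hm f => ⟨_, ⟨4 * m, by omega, rfl⟩, ?_⟩⟩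
  obtain ⟨A', hA'⟩ := RobotNet.computes_orientedPath hm f
  obtain ⟨A, hA⟩ := hdom (4 * m) (by omega) A'
  exact ⟨A, hA.trans hA'⟩
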